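/- Theorem 1 a) (Malgrange–Sibuya). Let $F(z,y_0,y_1,\dots,y_n)$ be a holomorphic function in a neighbourhood of $0\in\mathbb C^{n+2}$, and put $\delta=z\,\frac{d}{dz}$. Let $\hat\varphi\in\mathbb C[[z]]$ be a formal power series with $\hat\varphi(0)=0$, and put $\Phi=(\hat\varphi,\delta\hat\varphi,\dots,\delta^n\hat\varphi)$. For a function $G$ holomorphic near $0\in\mathbb C^{n+2}$, let $G(z,\Phi)\in\mathbb C[[z]]$ denote the formal power series obtained by substituting $(z,\Phi)$ into the Taylor series of $G$ at $0$. Suppose that $F(z,\Phi)=0$ and that $a_n:=\frac{\partial F}{\partial y_n}(z,\Phi)\neq0$ as a formal power series. Suppose further that $z=0$ is a Fuchsian singular point of the linearized operator $$L_{\hat\varphi}=\sum_{i=0}^n a_i\,\delta^i,\qquad a_i=\frac{\partial F}{\partial y_i}(z,\Phi)\in\mathbb C[[z]],$$ that is, $\operatorname{ord}_0 a_i\ge\operatorname{ord}_0 a_n$ for $i=0,\dots,n-1$ (with $\operatorname{ord}_0 0=+\infty$). Then the power series $\hat\varphi$ converges in a neighbourhood of $0$. -/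

import Mathlib

noncomputable section

namespace FormalODE

/-- The partial derivative `∂f/∂x_i` of a function of `N` complex variables. -/
def partialDeriv {N : ℕ} (i : Fin N) (f : (Fin N → ℂ) → ℂ) : (Fin N → ℂ) → ℂ :=
  fun x => fderiv ℂ f x (Pi.single i 1)

/-- The mixed partial derivative `∂_0^{m_0} ⋯ ∂_{N-1}^{m_{N-1}} f` for a multi-index `m`. -/
def mixedDeriv {N : ℕ} (m : Fin N →₀ ℕ) (f : (Fin N → ℂ) → ℂ) : (Fin N → ℂ) → ℂ :=
  (List.finRange N).foldr (fun i g => (partialDeriv i)^[m i] g) f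

/-- The Taylor series `∑_m (∂^m f (0) / m!) x^m` of `f` at the origin. -/
def taylorSeries {N : ℕ} (f : (Fin N → ℂ) → ℂ) : MvPowerSeries (Fin N) ℂ :=
  fun m => mixedDeriv m f 0 / ((∏ i, (m i).factorial : ℕ) : ℂ)

/-- The operator `δ = z d/dz` on formal power series. -/
def delta (φ : PowerSeries ℂ) : PowerSeries ℂ :=
  PowerSeries.X * PowerSeries.derivative ℂ φ

/-- The tuple `(z, Φ) = (z, φ, δφ, …, δⁿφ)`. -/
def jet (n : ℕ) (φ : PowerSeries ℂ) : Fin (n + 2) → PowerSeries ℂ :=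
  Fin.cons PowerSeries.X (fun i : Fin (n + 1) => delta^[(i : ℕ)] φ)

/-- If `φ(0) = 0`, the tuple `(z, Φ)` may be substituted into formal power series, so that
`MvPowerSeries.subst` takes no default value in `alongJet` below. -/
theorem hasSubst_jet (n : ℕ) (φ : PowerSeries ℂ) (h : PowerSeries.constantCoeff φ = 0) :
    MvPowerSeries.HasSubst (S := ℂ) (jet n φ) := by
  have key : ∀ k : ℕ, PowerSeries.constantCoeff (delta^[k] φ) = 0 := by
    intro k
    cases k with
    | zero => simpa using h
    | succ k => rw [Function.iterate_succ_apply']; simp [delta]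
  apply MvPowerSeries.hasSubst_of_constantCoeff_zero
  intro s
  refine Fin.cases ?_ (fun i => ?_) s
  · exact PowerSeries.constantCoeff_X
  · exact key i

/-- The formal power series `f(z, Φ) = f(z, φ, δφ, …, δⁿφ)`: the formal substitution of
`(z, Φ)` into the Taylor series of `f` at the origin. The variable `x 0` of `f` is `z`, and
`x (i + 1)` is `y_i`. -/
def alongJet {n : ℕ} (f : (Fin (n + 2) → ℂ) → ℂ) (φ : PowerSeries ℂ) : PowerSeries ℂ :=
  MvPowerSeries.subst (jet n φ) (taylorSeries f)

/-- The coefficients `a_i = ∂F/∂y_i (z, Φ)`, `0 ≤ i ≤ n`, of the linearized operator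
`L_φ = ∑ a_i δ^i`. -/
def linearizedCoeff {n : ℕ} (F : (Fin (n + 2) → ℂ) → ℂ) (φ : PowerSeries ℂ) :
    Fin (n + 1) → PowerSeries ℂ :=
  fun i => alongJet (partialDeriv i.succ F) φ

/-- `z = 0` is a Fuchsian singular point of `L = ∑_{i ≤ n} a_i δ^i`:
`ord_0 a_i ≥ ord_0 a_n` for `i < n`. -/
def IsFuchsian {n : ℕ} (a : Fin (n + 1) → PowerSeries ℂ) : Prop :=
  ∀ i : Fin n, (a (Fin.last n)).order ≤ (a i.castSucc).order

/-- The power series `φ` converges in a neighbourhood of `0`. -/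
def Converges (φ : PowerSeries ℂ) : Prop :=
  ∃ r : ℝ, 0 < r ∧ ∀ z : ℂ, ‖z‖ < r → Summable (fun j : ℕ => PowerSeries.coeff j φ * z ^ j)

end FormalODE

end

open Filter Topology MvPowerSeries
open scoped ENNReal

namespace FormalODE

/-! ### Partial derivatives, Cauchy estimates and Taylor coefficients. -/

variable {N : ℕ}

/-! Let `p` be the order of `a_n`, and `c_i` the coefficient of `z^p` in `a_i`. Write `φ = P + z^k
ψ` with `P` the truncation in degrees `≤ k`, so `ψ(0) = 0`, and substitute `y_i = δ^i P + z^k Y_i`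
in `F`. If `k > p`, then modulo `z^(k+p+1)` only `z^(k+p) ∑ c_i Y_i` survives: terms of degree at
least two in `Y` carry `z^(2k)`, the Fuchsian condition makes the linear part divisible by
`z^(k+p)`, and `F(z, Φ) = 0` then kills the `Y`-free part up to degree `k+p`. Hence the equation
reads `z^(k+p) ∑ c_i (δ+k)^i ψ = E(z, ψ, (δ+k)ψ, …, (δ+k)^n ψ)` up to sign, with `E` convergent and
divisible by `z^(k+p+1)`.

On the coefficient of `z^j` the left-hand operator is multiplication by `∑ c_i (j+k)^i`. Since `c_n
≠ 0`, this is at least `|c_n| (j+k)^n / 2` in modulus for large `k` (`exists_norm_sum_ge`), so it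
controls all the derivatives occurring in `E`. The extra factor `z` makes the equation a recursion
for the coefficients, and a weighted `ℓ¹` estimate closes on a small disc
(`exists_tsum_le_one_of_majorant`). No fixed point theorem is needed, because the formal solution is
given: only its partial sums are bounded. The reduction is assembled in `converges_of_isFuchsian`.
-/

theorem partialDeriv_congr {f g : (Fin N → ℂ) → ℂ} {x : Fin N → ℂ} (i : Fin N)
    (h : f =ᶠ[𝓝 x] g) : partialDeriv i f =ᶠ[𝓝 x] partialDeriv i g := by
  filter_upwards [h.fderiv (𝕜 := ℂ)] with y hy
  simp only [partialDeriv, hy]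

theorem analyticAt_partialDeriv {f : (Fin N → ℂ) → ℂ} {x : Fin N → ℂ} (i : Fin N)
    (h : AnalyticAt ℂ f x) : AnalyticAt ℂ (partialDeriv i f) x :=
  (ContinuousLinearMap.apply ℂ ℂ (Pi.single i 1 : Fin N → ℂ)).analyticAt _ |>.comp h.fderiv

theorem partialDeriv_comm {f : (Fin N → ℂ) → ℂ} {x : Fin N → ℂ} (h : AnalyticAt ℂ f x)
    (i j : Fin N) :
    partialDeriv i (partialDeriv j f) =ᶠ[𝓝 x] partialDeriv j (partialDeriv i f) := by
  filter_upwards [h.eventually_analyticAt] with y hy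
  have hd : DifferentiableAt ℂ (fderiv ℂ f) y := hy.fderiv.differentiableAt
  have key : ∀ a b : Fin N, partialDeriv a (partialDeriv b f) y
      = fderiv ℂ (fderiv ℂ f) y (Pi.single a 1) (Pi.single b 1) := by
    intro a b
    change fderiv ℂ (fun z => fderiv ℂ f z (Pi.single b 1)) y (Pi.single a 1) = _
    rw [fderiv_clm_apply hd (differentiableAt_const _)]
    simp
  rw [key, key]
  have hs : IsSymmSndFDerivAt ℂ f y :=
    (hy.contDiffAt (n := 2)).isSymmSndFDerivAt (by simp)
  exact hs.eq _ _

theorem iterate_partialDeriv_congr {f g : (Fin N → ℂ) → ℂ} {x : Fin N → ℂ} (i : Fin N) (k : ℕ)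
    (h : f =ᶠ[𝓝 x] g) : (partialDeriv i)^[k] f =ᶠ[𝓝 x] (partialDeriv i)^[k] g := by
  induction k with
  | zero => exact h
  | succ k ih =>
    simp only [Function.iterate_succ_apply']
    exact partialDeriv_congr i ih

theorem analyticAt_iterate_partialDeriv {f : (Fin N → ℂ) → ℂ} {x : Fin N → ℂ} (i : Fin N) (k : ℕ)
    (h : AnalyticAt ℂ f x) : AnalyticAt ℂ ((partialDeriv i)^[k] f) x := by
  induction k with
  | zero => exact h
  | succ k ih =>
    simp only [Function.iterate_succ_apply']
    exact analyticAt_partialDeriv i ih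

theorem iterate_partialDeriv_comm {f : (Fin N → ℂ) → ℂ} {x : Fin N → ℂ} (h : AnalyticAt ℂ f x)
    (i j : Fin N) (k : ℕ) :
    (partialDeriv i)^[k] (partialDeriv j f) =ᶠ[𝓝 x] partialDeriv j ((partialDeriv i)^[k] f) := by
  induction k with
  | zero => rfl
  | succ k ih =>
    simp only [Function.iterate_succ_apply']
    exact (partialDeriv_congr i ih).trans
      (partialDeriv_comm (analyticAt_iterate_partialDeriv i k h) i j)

theorem analyticAt_foldr_partialDeriv {f : (Fin N → ℂ) → ℂ} {x : Fin N → ℂ} (m : Fin N → ℕ)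
    (l : List (Fin N)) (h : AnalyticAt ℂ f x) :
    AnalyticAt ℂ (l.foldr (fun i g => (partialDeriv i)^[m i] g) f) x := by
  induction l with
  | nil => exact h
  | cons a l ih => exact analyticAt_iterate_partialDeriv a _ ih

theorem foldr_partialDeriv_comm {f : (Fin N → ℂ) → ℂ} {x : Fin N → ℂ} (m : Fin N → ℕ)
    (j : Fin N) (l : List (Fin N)) (h : AnalyticAt ℂ f x) :
    l.foldr (fun i g => (partialDeriv i)^[m i] g) (partialDeriv j f) =ᶠ[𝓝 x]
      partialDeriv j (l.foldr (fun i g => (partialDeriv i)^[m i] g) f) := by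
  induction l with
  | nil => rfl
  | cons a l ih =>
    exact (iterate_partialDeriv_congr a _ ih).trans
      (iterate_partialDeriv_comm (analyticAt_foldr_partialDeriv m l h) a j _)

/-- `mixedDeriv` differentiates in a fixed order, so the innermost `∂_j` is commuted outwards until
it meets the block `∂_j^(m j)`; `l.Nodup` ensures that there is only one such block. -/
theorem foldr_partialDeriv_add_single {f : (Fin N → ℂ) → ℂ} {x : Fin N → ℂ} (m : Fin N →₀ ℕ)
    (j : Fin N) (l : List (Fin N)) (hl : l.Nodup) (hj : j ∈ l) (h : AnalyticAt ℂ f x) :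
    l.foldr (fun i g => (partialDeriv i)^[m i] g) (partialDeriv j f) =ᶠ[𝓝 x]
      l.foldr (fun i g => (partialDeriv i)^[(m + Finsupp.single j 1 : Fin N →₀ ℕ) i] g) f := by
  induction l with
  | nil => simp at hj
  | cons a l ih =>
    obtain ⟨ha, hl⟩ := List.nodup_cons.1 hl
    by_cases haj : a = j
    · subst haj
      have h1 : l.foldr (fun i g => (partialDeriv i)^[(m + Finsupp.single a 1 : Fin N →₀ ℕ) i] g) f
          = l.foldr (fun i g => (partialDeriv i)^[m i] g) f := by
        apply List.foldr_ext
        intro i hi g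
        have : a ≠ i := fun h => ha (h ▸ hi)
        simp [this]
      simp only [List.foldr_cons, h1]
      refine (iterate_partialDeriv_congr a _ (foldr_partialDeriv_comm m a l h)).trans ?_
      simp only [Finsupp.add_apply, Finsupp.single_eq_same, Function.iterate_succ_apply]
      rfl
    · have hj : j ∈ l := by simpa [Ne.symm haj] using hj
      have h1 : (m + Finsupp.single j 1 : Fin N →₀ ℕ) a = m a := by simp [Ne.symm haj]
      simp only [List.foldr_cons, h1]
      exact iterate_partialDeriv_congr a _ (ih hl hj)

theorem taylorSeries_partialDeriv {f : (Fin N → ℂ) → ℂ} (h : AnalyticAt ℂ f 0) (i : Fin N) :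
    taylorSeries (partialDeriv i f) = pderiv ℂ i (taylorSeries f) := by
  ext m
  rw [coeff_pderiv]
  change mixedDeriv m (partialDeriv i f) 0 / _
    = mixedDeriv (m + Finsupp.single i 1) f 0 / _ * _
  have h1 : mixedDeriv m (partialDeriv i f) 0 = mixedDeriv (m + Finsupp.single i 1) f 0 :=
    (foldr_partialDeriv_add_single m i _ (List.nodup_finRange N) (List.mem_finRange i) h).eq_of_nhds
  have h2 : (∏ j, ((m + Finsupp.single i 1 : Fin N →₀ ℕ) j).factorial) = (m i + 1) * ∏ j, (m j).factorial := by
    rw [← Finset.mul_prod_erase _ _ (Finset.mem_univ i),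
      ← Finset.mul_prod_erase _ (fun j => (m j).factorial) (Finset.mem_univ i)]
    have : ∀ j ∈ Finset.univ.erase i, ((m + Finsupp.single i 1 : Fin N →₀ ℕ) j).factorial = (m j).factorial := by
      intro j hj
      have : i ≠ j := (Finset.ne_of_mem_erase hj).symm
      simp [this]
    rw [Finset.prod_congr rfl this]
    simp [Nat.factorial_succ, mul_assoc]
  rw [h1, h2]
  have h3 : ((∏ j, (m j).factorial : ℕ) : ℂ) ≠ 0 := by
    exact_mod_cast (Finset.prod_pos fun j _ => (m j).factorial_pos).ne'
  have h4 : ((m i : ℂ) + 1) ≠ 0 := by exact_mod_cast (m i).succ_ne_zero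
  push_cast at h3 ⊢
  field_simp

theorem iteratedDeriv_comp_line {g : (Fin N → ℂ) → ℂ} {U : Set (Fin N → ℂ)} (hU : IsOpen U)
    (hg : AnalyticOnNhd ℂ g U) (i : Fin N) (x : Fin N → ℂ) (k : ℕ) :
    ∀ t : ℂ, x + t • Pi.single i 1 ∈ U →
      iteratedDeriv k (fun t : ℂ => g (x + t • Pi.single i 1)) t
        = (partialDeriv i)^[k] g (x + t • Pi.single i 1) := by
  have hc : Continuous fun t : ℂ => x + t • (Pi.single i 1 : Fin N → ℂ) := by fun_prop
  induction k with
  | zero => intro t _; simp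
  | succ k ih =>
    intro t ht
    rw [iteratedDeriv_succ, Function.iterate_succ_apply']
    have h1 : iteratedDeriv k (fun t : ℂ => g (x + t • Pi.single i 1)) =ᶠ[𝓝 t]
        fun t => (partialDeriv i)^[k] g (x + t • Pi.single i 1) := by
      filter_upwards [(hU.preimage hc).mem_nhds ht] with s hs using ih s hs
    rw [h1.deriv_eq]
    have hd := (analyticAt_iterate_partialDeriv i k (hg _ ht)).differentiableAt.hasFDerivAt
    have hl : HasDerivAt (fun t : ℂ => x + t • (Pi.single i 1 : Fin N → ℂ)) (Pi.single i 1) t := by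
      simpa using ((hasDerivAt_id t).smul_const (Pi.single i 1 : Fin N → ℂ)).const_add x
    exact (hd.comp_hasDerivAt t hl).deriv

/-- One-variable Cauchy estimate on the disc of radius `ε` about `x` in the direction of the `i`-th
coordinate. -/
theorem norm_iterate_partialDeriv_le {g : (Fin N → ℂ) → ℂ} {r ε M : ℝ} (hε : 0 < ε)
    (hg : AnalyticOnNhd ℂ g (Metric.ball 0 (r + ε)))
    (hM : ∀ x ∈ Metric.ball (0 : Fin N → ℂ) (r + ε), ‖g x‖ ≤ M) (i : Fin N) (k : ℕ) :
    ∀ x ∈ Metric.ball (0 : Fin N → ℂ) r, ‖(partialDeriv i)^[k] g x‖ ≤ k.factorial * M / ε ^ k := by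
  intro x hx
  have hline : ∀ t ∈ Metric.closedBall (0 : ℂ) ε,
      x + t • (Pi.single i 1 : Fin N → ℂ) ∈ Metric.ball (0 : Fin N → ℂ) (r + ε) := by
    intro t ht
    rw [mem_ball_zero_iff] at hx ⊢
    rw [mem_closedBall_zero_iff] at ht
    have h1 : ‖t • (Pi.single i 1 : Fin N → ℂ)‖ ≤ ε := by
      rw [norm_smul, Pi.norm_single]
      simpa using ht
    linarith [norm_add_le x (t • (Pi.single i 1 : Fin N → ℂ))]
  have h0 := iteratedDeriv_comp_line Metric.isOpen_ball hg i x k 0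
    (hline 0 (Metric.mem_closedBall_self hε.le))
  rw [zero_smul, add_zero] at h0
  rw [← h0]
  refine Complex.norm_iteratedDeriv_le_of_forall_mem_sphere_norm_le k hε ?_ fun t ht =>
    hM _ (hline t (Metric.sphere_subset_closedBall ht))
  have hd : DifferentiableOn ℂ (fun t : ℂ => g (x + t • Pi.single i 1))
      (Metric.closedBall 0 ε) := by
    intro t ht
    have hd := (hg _ (hline t ht)).differentiableAt
    have hl : DifferentiableAt ℂ (fun t : ℂ => x + t • (Pi.single i 1 : Fin N → ℂ)) t := by
      fun_prop
    exact (hd.comp t hl).differentiableWithinAt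
  refine DifferentiableOn.diffContOnCl ?_
  rwa [closure_ball _ hε.ne']

/-- The Cauchy estimate is applied one variable at a time; each variable costs `ε` of the radius,
whatever the order of differentiation. -/
theorem norm_foldr_partialDeriv_le {f : (Fin N → ℂ) → ℂ} {ε M : ℝ} (hε : 0 < ε)
    (m : Fin N → ℕ) (l : List (Fin N)) (r : ℝ)
    (hf : AnalyticOnNhd ℂ f (Metric.ball 0 (r + l.length * ε)))
    (hM : ∀ x ∈ Metric.ball (0 : Fin N → ℂ) (r + l.length * ε), ‖f x‖ ≤ M) :
    ∀ x ∈ Metric.ball (0 : Fin N → ℂ) r,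
      ‖l.foldr (fun i g => (partialDeriv i)^[m i] g) f x‖
        ≤ (l.map fun i => ((m i).factorial : ℝ) / ε ^ m i).prod * M := by
  induction l generalizing r with
  | nil => simpa using hM
  | cons a l ih =>
    have hr : r + ((a :: l).length : ℝ) * ε = (r + ε) + l.length * ε := by
      push_cast [List.length_cons]; ring
    rw [hr] at hf hM
    have hsub : Metric.ball (0 : Fin N → ℂ) (r + ε) ⊆ Metric.ball 0 ((r + ε) + l.length * ε) :=
      Metric.ball_subset_ball (by nlinarith [(Nat.cast_nonneg l.length : (0 : ℝ) ≤ l.length)])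
    intro x hx
    have := norm_iterate_partialDeriv_le hε
      (fun y hy => analyticAt_foldr_partialDeriv m l (hf y (hsub hy))) (ih (r + ε) hf hM) a (m a)
      x hx
    simp only [List.foldr_cons, List.map_cons, List.prod_cons]
    refine this.trans_eq ?_
    ring

theorem exists_norm_coeff_taylorSeries_le {f : (Fin N → ℂ) → ℂ} (hf : AnalyticAt ℂ f 0) :
    ∃ M ε : ℝ, 0 < ε ∧ ∀ m : Fin N →₀ ℕ, ‖coeff m (taylorSeries f)‖ ≤ M * ∏ i, (ε⁻¹) ^ m i := by
  have hb : ∀ᶠ x in 𝓝 (0 : Fin N → ℂ), AnalyticAt ℂ f x ∧ ‖f x‖ < ‖f 0‖ + 1 :=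
    hf.eventually_analyticAt.and
      (hf.continuousAt.norm.eventually (gt_mem_nhds (lt_add_one _)))
  obtain ⟨R, hR, hb⟩ := Metric.eventually_nhds_iff_ball.1 hb
  -- `N` variables cost `N ε`, and one more `ε` leaves a ball around the origin.
  set ε : ℝ := R / (N + 1) with hε
  have hεpos : 0 < ε := by positivity
  have hRε : ε + ((List.finRange N).length : ℝ) * ε = R := by
    rw [List.length_finRange, hε]; field_simp; ring
  refine ⟨‖f 0‖ + 1, ε, hεpos, fun m => ?_⟩
  have key := norm_foldr_partialDeriv_le (f := f) (M := ‖f 0‖ + 1) hεpos m (List.finRange N) ε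
    (by rw [hRε]; exact fun x hx => (hb x hx).1) (by rw [hRε]; exact fun x hx => (hb x hx).2.le)
    0 (Metric.mem_ball_self hεpos)
  rw [← List.ofFn_eq_map, List.prod_ofFn, Finset.prod_div_distrib] at key
  change ‖mixedDeriv m f 0 / _‖ ≤ _
  have hpos : (0 : ℝ) < ∏ i, ((m i).factorial : ℝ) :=
    Finset.prod_pos fun i _ => by exact_mod_cast (m i).factorial_pos
  have hn : ‖((∏ i, (m i).factorial : ℕ) : ℂ)‖ = ∏ i, ((m i).factorial : ℝ) := by
    rw [Complex.norm_natCast]; push_cast; rfl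
  rw [norm_div, hn, div_le_iff₀ hpos]
  refine (key : ‖mixedDeriv m f 0‖ ≤ _).trans_eq ?_
  simp only [inv_pow, Finset.prod_inv_distrib]
  ring

/-! ### Weighted `ℓ¹`-norms of formal power series. -/

variable {σ τ : Type*}

/-- The weighted `ℓ¹`-norm `∑_d |f_d| ρ^d` of a formal power series, with values in `[0, ∞]`. -/
noncomputable def weightedNorm (ρ : σ → ℝ≥0∞) (f : MvPowerSeries σ ℂ) : ℝ≥0∞ :=
  ∑' d : σ →₀ ℕ, ‖coeff d f‖ₑ * d.prod fun s e => ρ s ^ e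

theorem prod_pow_add (ρ : σ → ℝ≥0∞) (d e : σ →₀ ℕ) :
    ((d + e).prod fun s k => ρ s ^ k) = (d.prod fun s k => ρ s ^ k) * e.prod fun s k => ρ s ^ k :=
  Finsupp.prod_add_index' (fun _ => pow_zero _) (fun _ _ _ => pow_add _ _ _)

theorem weightedNorm_mono_weight {ρ ρ' : σ → ℝ≥0∞} (h : ρ ≤ ρ') (f : MvPowerSeries σ ℂ) :
    weightedNorm ρ f ≤ weightedNorm ρ' f :=
  ENNReal.tsum_le_tsum fun _ => mul_le_mul_right
    (Finset.prod_le_prod' fun s _ => pow_le_pow_left' (h s) _) _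

theorem weightedNorm_add_le (ρ : σ → ℝ≥0∞) (f g : MvPowerSeries σ ℂ) :
    weightedNorm ρ (f + g) ≤ weightedNorm ρ f + weightedNorm ρ g := by
  unfold weightedNorm
  rw [← ENNReal.tsum_add]
  refine ENNReal.tsum_le_tsum fun d => ?_
  rw [map_add, ← add_mul]
  exact mul_le_mul_left (enorm_add_le _ _) _

theorem weightedNorm_monomial (ρ : σ → ℝ≥0∞) (d : σ →₀ ℕ) (c : ℂ) :
    weightedNorm ρ (monomial d c) = ‖c‖ₑ * d.prod fun s e => ρ s ^ e := by
  classical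
  unfold weightedNorm
  rw [tsum_eq_single d]
  · rw [coeff_monomial_same]
  · intro e he
    rw [coeff_monomial_ne he]
    simp

theorem weightedNorm_one (ρ : σ → ℝ≥0∞) : weightedNorm ρ (1 : MvPowerSeries σ ℂ) = 1 := by
  rw [← monomial_zero_one, weightedNorm_monomial]
  simp

theorem weightedNorm_mul_le (ρ : σ → ℝ≥0∞) (f g : MvPowerSeries σ ℂ) :
    weightedNorm ρ (f * g) ≤ weightedNorm ρ f * weightedNorm ρ g := by
  classical
  have h1 : weightedNorm ρ f * weightedNorm ρ g = ∑' p : (σ →₀ ℕ) × (σ →₀ ℕ),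
      (‖coeff p.1 f‖ₑ * p.1.prod fun s e => ρ s ^ e) *
        (‖coeff p.2 g‖ₑ * p.2.prod fun s e => ρ s ^ e) := by
    rw [ENNReal.tsum_prod', weightedNorm, weightedNorm, ← ENNReal.tsum_mul_right]
    simp_rw [ENNReal.tsum_mul_left]
  rw [h1, ← Finset.HasAntidiagonal.sigmaAntidiagonalEquivProd.tsum_eq, ENNReal.tsum_sigma']
  refine ENNReal.tsum_le_tsum fun d => ?_
  rw [coeff_mul, tsum_fintype]
  simp only [Finset.HasAntidiagonal.sigmaAntidiagonalEquivProd_apply]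
  rw [Finset.sum_coe_sort (Finset.HasAntidiagonal.antidiagonal d) (fun p : (σ →₀ ℕ) × (σ →₀ ℕ) =>
    (‖coeff p.1 f‖ₑ * p.1.prod fun s e => ρ s ^ e) *
        (‖coeff p.2 g‖ₑ * p.2.prod fun s e => ρ s ^ e))]
  refine (mul_le_mul_left (enorm_sum_le _ _) _).trans ?_
  rw [Finset.sum_mul]
  refine Finset.sum_le_sum fun p hp => ?_
  rw [← Finset.HasAntidiagonal.mem_antidiagonal.1 hp, prod_pow_add, enorm_mul]
  exact (mul_mul_mul_comm _ _ _ _).le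

theorem weightedNorm_pow_le (ρ : σ → ℝ≥0∞) (f : MvPowerSeries σ ℂ) (k : ℕ) :
    weightedNorm ρ (f ^ k) ≤ weightedNorm ρ f ^ k := by
  induction k with
  | zero => simp [weightedNorm_one]
  | succ k ih =>
    rw [pow_succ, pow_succ]
    exact (weightedNorm_mul_le _ _ _).trans (mul_le_mul_left ih _)

theorem weightedNorm_prod_le {ι : Type*} (ρ : σ → ℝ≥0∞) (s : Finset ι)
    (f : ι → MvPowerSeries σ ℂ) :
    weightedNorm ρ (∏ i ∈ s, f i) ≤ ∏ i ∈ s, weightedNorm ρ (f i) := by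
  classical
  induction s using Finset.induction_on with
  | empty => simp [weightedNorm_one]
  | insert a s ha ih =>
    rw [Finset.prod_insert ha, Finset.prod_insert ha]
    exact (weightedNorm_mul_le _ _ _).trans (mul_le_mul_right ih _)

theorem weightedNorm_sum_le {ι : Type*} (ρ : σ → ℝ≥0∞) (s : Finset ι)
    (f : ι → MvPowerSeries σ ℂ) :
    weightedNorm ρ (∑ i ∈ s, f i) ≤ ∑ i ∈ s, weightedNorm ρ (f i) := by
  classical
  induction s using Finset.induction_on with
  | empty => simp [weightedNorm]
  | insert a s ha ih =>
    rw [Finset.sum_insert ha, Finset.sum_insert ha]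
    exact (weightedNorm_add_le _ _ _).trans (add_le_add_right ih _)

/-- Triangle inequality, exchange of the two sums, and submultiplicativity. With values in `[0, ∞]`
no summability has to be checked. -/
theorem weightedNorm_subst_le (ρ : τ → ℝ≥0∞) {a : σ → MvPowerSeries τ ℂ} (ha : HasSubst a)
    (f : MvPowerSeries σ ℂ) :
    weightedNorm ρ (subst a f) ≤ weightedNorm (fun s => weightedNorm ρ (a s)) f := by
  have h1 : ∀ e, ‖coeff e (subst a f)‖ₑ ≤
      ∑' d : σ →₀ ℕ, ‖coeff d f‖ₑ * ‖coeff e (d.prod fun s k => a s ^ k)‖ₑ := by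
    intro e
    rw [coeff_subst ha, finsum_eq_sum _ (coeff_subst_finite ha f e)]
    refine (enorm_sum_le _ _).trans ?_
    simp_rw [smul_eq_mul, enorm_mul]
    exact ENNReal.sum_le_tsum _
  calc weightedNorm ρ (subst a f)
      ≤ ∑' e : τ →₀ ℕ, (∑' d : σ →₀ ℕ, ‖coeff d f‖ₑ * ‖coeff e (d.prod fun s k => a s ^ k)‖ₑ) *
          e.prod fun s k => ρ s ^ k :=
        ENNReal.tsum_le_tsum fun e => mul_le_mul_left (h1 e) _
    _ = ∑' d : σ →₀ ℕ, ‖coeff d f‖ₑ * weightedNorm ρ (d.prod fun s k => a s ^ k) := by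
        simp_rw [← ENNReal.tsum_mul_right]
        rw [ENNReal.tsum_comm]
        simp_rw [mul_assoc, ENNReal.tsum_mul_left]
        rfl
    _ ≤ _ := by
        refine ENNReal.tsum_le_tsum fun d => mul_le_mul_right ?_ _
        exact (weightedNorm_prod_le _ _ _).trans
          (Finset.prod_le_prod' fun s _ => weightedNorm_pow_le _ _ _)

theorem tsum_fin_prod (g : ℕ → ℝ≥0∞) (N : ℕ) :
    ∑' d : Fin N → ℕ, ∏ i, g (d i) = (∑' k, g k) ^ N := by
  induction N with
  | zero => simp
  | succ N ih =>
    rw [← (Fin.consEquiv fun _ : Fin (N + 1) => ℕ).tsum_eq, ENNReal.tsum_prod', pow_succ', ← ih,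
      ← ENNReal.tsum_mul_right]
    refine tsum_congr fun k => ?_
    rw [← ENNReal.tsum_mul_left]
    refine tsum_congr fun d => ?_
    simp [Fin.consEquiv, Fin.prod_univ_succ]

theorem exists_weightedNorm_taylorSeries_lt_top {N : ℕ} {f : (Fin N → ℂ) → ℂ}
    (hf : AnalyticAt ℂ f 0) :
    ∃ s : ℝ, 0 < s ∧ weightedNorm (fun _ => ENNReal.ofReal s) (taylorSeries f) < ⊤ := by
  obtain ⟨M, ε, hε, hM⟩ := exists_norm_coeff_taylorSeries_le hf
  -- Half the Cauchy radius bounds the norm by a constant times a product of geometric series of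
  -- ratio `1/2`.
  refine ⟨ε / 2, by positivity, ?_⟩
  have h1 : ∀ d : Fin N →₀ ℕ, ‖coeff d (taylorSeries f)‖ₑ *
      (d.prod fun _ e => ENNReal.ofReal (ε / 2) ^ e)
      ≤ ENNReal.ofReal M * ∏ i, (2⁻¹ : ℝ≥0∞) ^ d i := by
    intro d
    rw [Finsupp.prod_fintype _ _ (fun _ => pow_zero _)]
    have h0 : (0 : ℝ) ≤ ∏ i, ε⁻¹ ^ d i := Finset.prod_nonneg fun i _ => by positivity
    have h2 : ‖coeff d (taylorSeries f)‖ₑ ≤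
        ENNReal.ofReal M * ∏ i, ENNReal.ofReal ε⁻¹ ^ d i := by
      rw [← ofReal_norm]
      refine (ENNReal.ofReal_le_ofReal (hM d)).trans ?_
      rw [ENNReal.ofReal_mul' h0, ENNReal.ofReal_prod_of_nonneg fun i _ => by positivity]
      simp_rw [ENNReal.ofReal_pow (inv_nonneg.2 hε.le)]
      rfl
    refine (mul_le_mul_left h2 _).trans_eq ?_
    rw [mul_assoc, ← Finset.prod_mul_distrib]
    congr 1
    refine Finset.prod_congr rfl fun i _ => ?_
    rw [← mul_pow, ← ENNReal.ofReal_mul (inv_nonneg.2 hε.le)]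
    congr 1
    rw [show ε⁻¹ * (ε / 2) = 2⁻¹ by field_simp, ENNReal.ofReal_inv_of_pos two_pos]
    simp
  refine (ENNReal.tsum_le_tsum h1).trans_lt ?_
  rw [ENNReal.tsum_mul_left, ← Finsupp.equivFunOnFinite.symm.tsum_eq]
  simp only [Finsupp.equivFunOnFinite_symm_apply_apply]
  rw [tsum_fin_prod (fun k => (2⁻¹ : ℝ≥0∞) ^ k), ENNReal.tsum_geometric]
  refine ENNReal.mul_lt_top ENNReal.ofReal_lt_top (ENNReal.pow_lt_top ?_)
  simp

theorem weightedNorm_powerSeries (x : ℝ≥0∞) (f : PowerSeries ℂ) :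
    weightedNorm (fun _ : Unit => x) f = ∑' j : ℕ, ‖PowerSeries.coeff j f‖ₑ * x ^ j := by
  unfold weightedNorm
  rw [← (Finsupp.uniqueEquiv (M := ℕ) ()).symm.tsum_eq]
  refine tsum_congr fun j => ?_
  have : (Finsupp.uniqueEquiv (M := ℕ) ()).symm j = Finsupp.single () j := by
    ext; simp
  rw [this, Finsupp.prod_single_index (h := fun _ e => x ^ e) (pow_zero _)]
  rfl

/-- Every surviving monomial contains the first variable at least `q` times. This gain from
shrinking only the `z`-radius is the source of smallness in all later estimates. -/
theorem weightedNorm_mul_left_le {N : ℕ} {q : ℕ} {f : MvPowerSeries (Fin (N + 1)) ℂ}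
    (hf : ∀ d : Fin (N + 1) →₀ ℕ, d 0 < q → coeff d f = 0) {t : ℝ≥0∞} (ht : t ≤ 1) (x : ℝ≥0∞)
    (ρ : Fin N → ℝ≥0∞) :
    weightedNorm (Fin.cons (t * x) ρ : Fin (N + 1) → ℝ≥0∞) f
      ≤ t ^ q * weightedNorm (Fin.cons x ρ : Fin (N + 1) → ℝ≥0∞) f := by
  unfold weightedNorm
  rw [← ENNReal.tsum_mul_left]
  refine ENNReal.tsum_le_tsum fun d => ?_
  by_cases hd : d 0 < q
  · simp [hf d hd]
  · rw [Finsupp.prod_fintype _ _ (fun _ => pow_zero _),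
      Finsupp.prod_fintype _ _ (fun _ => pow_zero _), Fin.prod_univ_succ, Fin.prod_univ_succ]
    simp only [Fin.cons_zero, Fin.cons_succ, mul_pow]
    have h1 : t ^ d 0 ≤ t ^ q := pow_le_pow_right_of_le_one' ht (not_lt.1 hd)
    calc _ = t ^ d 0 * (‖coeff d f‖ₑ * (x ^ d 0 * ∏ i : Fin N, ρ i ^ d i.succ)) := by ring
      _ ≤ _ := mul_le_mul_left h1 _

/-! ### Formal substitution and the majorant argument. -/

/-- The coefficients of a substitution below degree `N` depend only on those of the substituted
series below degree `N`. -/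
theorem coeff_subst_congr {a b : σ → PowerSeries ℂ} (ha : HasSubst a) (hb : HasSubst b) {N : ℕ}
    (h : ∀ s, ∀ j < N, PowerSeries.coeff j (a s) = PowerSeries.coeff j (b s))
    (f : MvPowerSeries σ ℂ) {j : ℕ} (hj : j < N) :
    PowerSeries.coeff j (subst a f : PowerSeries ℂ) = PowerSeries.coeff j (subst b f : PowerSeries ℂ) := by
  have hprod : ∀ d : σ →₀ ℕ, PowerSeries.coeff j (d.prod fun s e => a s ^ e)
      = PowerSeries.coeff j (d.prod fun s e => b s ^ e) := by
    intro d
    -- Agreement below degree `N` is congruence modulo `X ^ N`, which products respect.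
    set I : Ideal (PowerSeries ℂ) := Ideal.span {PowerSeries.X ^ N}
    have hab : ∀ s, Ideal.Quotient.mk I (a s) = Ideal.Quotient.mk I (b s) := by
      intro s
      rw [Ideal.Quotient.eq, Ideal.mem_span_singleton, PowerSeries.X_pow_dvd_iff]
      intro m hm
      rw [map_sub, h s m hm, sub_self]
    have : Ideal.Quotient.mk I (d.prod fun s e => a s ^ e)
        = Ideal.Quotient.mk I (d.prod fun s e => b s ^ e) := by
      simp only [Finsupp.prod, map_prod, map_pow, hab]
    rw [Ideal.Quotient.eq, Ideal.mem_span_singleton, PowerSeries.X_pow_dvd_iff] at this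
    have := this j hj
    rwa [map_sub, sub_eq_zero] at this
  unfold PowerSeries.coeff at hprod ⊢
  rw [coeff_subst ha, coeff_subst hb]
  exact finsum_congr fun d => by rw [hprod d]

open scoped MvPowerSeries.WithPiTopology in
theorem continuous_pderiv {R : Type*} [CommRing R] [TopologicalSpace R] [DiscreteTopology R]
    (i : σ) : Continuous (pderiv R i : MvPowerSeries σ R → MvPowerSeries σ R) := by
  refine continuous_pi fun d => ?_
  change Continuous fun f => coeff d (pderiv R i f)
  simp only [coeff_pderiv]
  exact (continuous_of_discreteTopology (f := fun r : R => r * ((d i : R) + 1))).comp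
    (WithPiTopology.continuous_coeff R _)

open scoped MvPowerSeries.WithPiTopology in
/-- Chain rule for a substitution in which only the series put in for `x_t` involves `x_i`. -/
theorem pderiv_subst {R : Type*} [CommRing R] {b : σ → MvPowerSeries τ R} (hb : HasSubst b)
    (i : τ) (t : σ) (h : ∀ s, s ≠ t → pderiv R i (b s) = 0) (f : MvPowerSeries σ R) :
    pderiv R i (subst b f) = subst b (pderiv R t f) * pderiv R i (b t) := by
  classical
  -- With `R` discrete, both sides are continuous in `f` and polynomials are dense, so polynomials
  -- suffice.
  let : UniformSpace R := ⊥
  have : DiscreteUniformity R := ⟨rfl⟩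
  have hs : Continuous (subst b : MvPowerSeries σ R → MvPowerSeries τ R) := continuous_subst hb
  have h1 : Continuous fun f : MvPowerSeries σ R => pderiv R i (subst b f) :=
    (continuous_pderiv i).comp hs
  have h2 : Continuous fun f : MvPowerSeries σ R => subst b (pderiv R t f) * pderiv R i (b t) :=
    (hs.comp (continuous_pderiv t)).mul continuous_const
  refine congrFun (DenseRange.equalizer WithPiTopology.denseRange_toMvPowerSeries h1 h2 ?_) f
  funext p
  change pderiv R i (subst b (p : MvPowerSeries σ R))
    = subst b (pderiv R t (p : MvPowerSeries σ R)) * pderiv R i (b t)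
  induction p using MvPolynomial.induction_on with
  | C r =>
    rw [MvPolynomial.coe_C, pderiv_C, ← coe_substAlgHom hb, map_zero, zero_mul]
    have : (C r : MvPowerSeries σ R) = algebraMap R _ r := rfl
    rw [this, AlgHom.commutes]
    exact pderiv_C
  | add p q hp hq =>
    rw [MvPolynomial.coe_add, subst_add hb, map_add, map_add, hp, hq, subst_add hb, add_mul]
  | mul_X p s hp =>
    rw [MvPolynomial.coe_mul, MvPolynomial.coe_X, subst_mul hb, subst_X hb, Derivation.leibniz,
      Derivation.leibniz, hp, subst_add hb, smul_eq_mul, smul_eq_mul, smul_eq_mul, smul_eq_mul,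
      subst_mul hb, subst_mul hb, subst_X hb]
    by_cases hst : s = t
    · subst hst
      rw [pderiv_X_self, ← coe_substAlgHom hb, map_one]
      ring
    · rw [h s hst, pderiv_X_of_ne hst, ← coe_substAlgHom hb, map_zero]
      ring

/-- Setting all variables but the first one to zero. -/
theorem coeff_subst_cons_X_zero {N : ℕ} (f : MvPowerSeries (Fin (N + 1)) ℂ) (a : ℕ) :
    PowerSeries.coeff a
      (subst (Fin.cons PowerSeries.X 0 : Fin (N + 1) → PowerSeries ℂ) f : PowerSeries ℂ)
      = coeff (Finsupp.single 0 a) f := by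
  have hs : HasSubst (S := ℂ) (Fin.cons PowerSeries.X 0 : Fin (N + 1) → PowerSeries ℂ) :=
    hasSubst_of_constantCoeff_zero fun s =>
      Fin.cases PowerSeries.constantCoeff_X (fun i => map_zero _) s
  rw [PowerSeries.coeff, coeff_subst hs, finsum_eq_single _ (Finsupp.single 0 a)]
  · rw [Finsupp.prod_single_index (h := fun s e =>
      (Fin.cons PowerSeries.X 0 : Fin (N + 1) → PowerSeries ℂ) s ^ e) (pow_zero _), Fin.cons_zero]
    change _ • PowerSeries.coeff a (PowerSeries.X ^ a) = _
    rw [PowerSeries.coeff_X_pow_self, smul_eq_mul, mul_one]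
  · intro d hd
    change _ • PowerSeries.coeff a _ = _
    rw [Finsupp.prod_fintype _ _ (fun _ => pow_zero _), Fin.prod_univ_succ]
    by_cases h : ∃ i : Fin N, d i.succ ≠ 0
    · obtain ⟨i, hi⟩ := h
      rw [Finset.prod_eq_zero (Finset.mem_univ i), mul_zero, map_zero, smul_zero]
      simp [hi]
    · push Not at h
      have hda : a ≠ d 0 := by
        intro hda
        refine hd (Finsupp.ext fun s => ?_)
        refine Fin.cases ?_ (fun i => ?_) s
        · simp [hda]
        · simp [h i]
      simp [h, PowerSeries.coeff_X_pow, hda]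

/-- Since `E` is divisible by `z^(q+1)`, the coefficient of degree `j + q` in `E(z, Ψ)` sees only
the coefficients of `Ψ` below degree `j`. So if `∑_{j<M} w_j r^j ≤ 1`, the truncations of `Ψ` at `M`
have norm at most `1`, lie in the polydisc where `E` is bounded, and control the next partial sum.
The spare factor `z` supplies the small constant that reproduces the bound `1`. -/
theorem exists_tsum_le_one_of_majorant {N q : ℕ} {E : MvPowerSeries (Fin (N + 1)) ℂ}
    (hE : ∀ d : Fin (N + 1) →₀ ℕ, d 0 < q + 1 → coeff d E = 0) {r₀ : ℝ} (hr₀ : 0 < r₀)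
    (hfin : weightedNorm (Fin.cons (ENNReal.ofReal r₀) 1 : Fin (N + 1) → ℝ≥0∞) E ≠ ⊤)
    {Ψ : Fin N → PowerSeries ℂ} (hΨ : ∀ i, PowerSeries.constantCoeff (Ψ i) = 0)
    {w : ℕ → ℝ≥0∞} (hw : ∀ i j, ‖PowerSeries.coeff j (Ψ i)‖ₑ ≤ w j) {A : ℝ≥0∞} (hA : A ≠ ⊤)
    (hwE : ∀ j, w j ≤ A * ‖PowerSeries.coeff (j + q)
      (subst (Fin.cons PowerSeries.X Ψ : Fin (N + 1) → PowerSeries ℂ) E : PowerSeries ℂ)‖ₑ) :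
    ∃ r : ℝ, 0 < r ∧ ∑' j, w j * ENNReal.ofReal r ^ j ≤ 1 := by
  set K := weightedNorm (Fin.cons (ENNReal.ofReal r₀) 1 : Fin (N + 1) → ℝ≥0∞) E
  obtain ⟨t, ht0, ht1, ht⟩ : ∃ t : ℝ, 0 < t ∧ t ≤ 1 ∧
      ENNReal.ofReal t * (A * K) ≤ ENNReal.ofReal r₀ ^ q := by
    have hAK : A * K ≠ ⊤ := ENNReal.mul_ne_top hA hfin
    -- The `+ 1` guards against `A * K = 0`.
    refine ⟨min 1 (r₀ ^ q / ((A * K).toReal + 1)), by positivity, min_le_left _ _, ?_⟩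
    rw [← ENNReal.ofReal_toReal hAK, ← ENNReal.ofReal_mul (by positivity),
      ← ENNReal.ofReal_pow hr₀.le, ENNReal.toReal_ofReal ENNReal.toReal_nonneg]
    refine ENNReal.ofReal_le_ofReal ?_
    have h0 : 0 ≤ (A * K).toReal := ENNReal.toReal_nonneg
    calc _ ≤ r₀ ^ q / ((A * K).toReal + 1) * ((A * K).toReal + 1) :=
          mul_le_mul (min_le_right _ _) (by linarith) h0 (by positivity)
      _ = r₀ ^ q := by field_simp
  have hrpos : 0 < t * r₀ := by positivity
  refine ⟨t * r₀, hrpos, ?_⟩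
  set r : ℝ≥0∞ := ENNReal.ofReal (t * r₀) with hr
  have hrt : r = ENNReal.ofReal t * ENNReal.ofReal r₀ := ENNReal.ofReal_mul ht0.le
  have hr0 : r ≠ 0 := by simpa [hr] using hrpos
  have hcons : ∀ Θ : Fin N → PowerSeries ℂ, (∀ i, PowerSeries.constantCoeff (Θ i) = 0) →
      HasSubst (S := ℂ) (Fin.cons PowerSeries.X Θ : Fin (N + 1) → PowerSeries ℂ) := fun Θ hΘ =>
    hasSubst_of_constantCoeff_zero fun s =>
      Fin.cases PowerSeries.constantCoeff_X (fun i => hΘ i) s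
  have hdvd : (X 0 : MvPowerSeries (Fin (N + 1)) ℂ) ^ (q + 1) ∣ E := X_pow_dvd_iff.2 hE
  obtain ⟨G, hG⟩ := hdvd
  rw [ENNReal.tsum_eq_iSup_nat]
  refine iSup_le fun M => ?_
  induction M with
  | zero => simp
  | succ M ih =>
    set T : Fin N → PowerSeries ℂ := fun i => (PowerSeries.trunc M (Ψ i) : Polynomial ℂ) with hT
    have hTc : ∀ i j, PowerSeries.coeff j (T i)
        = if j < M then PowerSeries.coeff j (Ψ i) else 0 := by
      intro i j
      simp only [hT, Polynomial.coeff_coe, PowerSeries.coeff_trunc]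
    have hT0 : ∀ i, PowerSeries.constantCoeff (T i) = 0 := by
      intro i
      rw [← PowerSeries.coeff_zero_eq_constantCoeff_apply, hTc]
      split_ifs
      · rw [PowerSeries.coeff_zero_eq_constantCoeff_apply, hΨ]
      · rfl
    have hTn : ∀ i, weightedNorm (fun _ : Unit => r) (T i) ≤ 1 := by
      intro i
      rw [weightedNorm_powerSeries, tsum_eq_sum (s := Finset.range M)]
      · refine le_trans (Finset.sum_le_sum fun j hj => ?_) ih
        rw [hTc, if_pos (Finset.mem_range.1 hj)]
        exact mul_le_mul_left (hw i j) _
      · intro j hj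
        rw [hTc, if_neg (by simpa using hj)]
        simp
    have hcoef : ∀ j < M + 1, PowerSeries.coeff (j + q)
        (subst (Fin.cons PowerSeries.X Ψ : Fin (N + 1) → PowerSeries ℂ) E : PowerSeries ℂ)
        = PowerSeries.coeff (j + q)
        (subst (Fin.cons PowerSeries.X T : Fin (N + 1) → PowerSeries ℂ) E : PowerSeries ℂ) := by
      intro j hj
      rw [hG, subst_mul (hcons Ψ hΨ), subst_mul (hcons T hT0), subst_pow (hcons Ψ hΨ),
        subst_pow (hcons T hT0), subst_X (hcons Ψ hΨ), subst_X (hcons T hT0), Fin.cons_zero,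
        Fin.cons_zero, PowerSeries.coeff_X_pow_mul', PowerSeries.coeff_X_pow_mul']
      split_ifs with hjq
      -- After removal of `X ^ (q + 1)` the degree is `j - 1 < M`, where `Ψ` and `T` agree.
      · refine coeff_subst_congr (hcons Ψ hΨ) (hcons T hT0) (N := M) ?_ G (by omega)
        intro s m hm
        refine Fin.cases rfl (fun i => ?_) s
        simp only [Fin.cons_succ]
        rw [hTc, if_pos hm]
      · rfl
    have hTE : weightedNorm (fun _ : Unit => r)
        (subst (Fin.cons PowerSeries.X T : Fin (N + 1) → PowerSeries ℂ) E : PowerSeries ℂ)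
        ≤ ENNReal.ofReal t ^ (q + 1) * K := by
      refine (weightedNorm_subst_le _ (hcons T hT0) E).trans ?_
      refine le_trans (weightedNorm_mono_weight ?_ E)
        (weightedNorm_mul_left_le hE (ENNReal.ofReal_le_one.2 ht1) (ENNReal.ofReal r₀) 1)
      intro s
      refine Fin.cases ?_ (fun i => ?_) s
      · simp only [Fin.cons_zero]
        rw [← hrt, PowerSeries.X, X, weightedNorm_monomial,
          Finsupp.prod_single_index (h := fun _ e => r ^ e) (pow_zero _)]
        simp
      · exact hTn i
    have hsum : (∑ j ∈ Finset.range (M + 1), w j * r ^ j) * r ^ q ≤ 1 * r ^ q := by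
      calc (∑ j ∈ Finset.range (M + 1), w j * r ^ j) * r ^ q
          ≤ ∑ j ∈ Finset.range (M + 1), A * (‖PowerSeries.coeff (j + q) (subst
              (Fin.cons PowerSeries.X T : Fin (N + 1) → PowerSeries ℂ) E : PowerSeries ℂ)‖ₑ
                * r ^ (j + q)) := by
            rw [Finset.sum_mul]
            refine Finset.sum_le_sum fun j hj => ?_
            rw [← hcoef j (Finset.mem_range.1 hj), mul_assoc, ← pow_add, ← mul_assoc]
            exact mul_le_mul_left (hwE j) _
        _ = A * ∑ j ∈ Finset.range (M + 1), (‖PowerSeries.coeff (j + q) (subst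
              (Fin.cons PowerSeries.X T : Fin (N + 1) → PowerSeries ℂ) E : PowerSeries ℂ)‖ₑ
                * r ^ (j + q)) := by rw [Finset.mul_sum]
        _ ≤ A * weightedNorm (fun _ : Unit => r) (subst
              (Fin.cons PowerSeries.X T : Fin (N + 1) → PowerSeries ℂ) E : PowerSeries ℂ) := by
            refine mul_le_mul_right ?_ _
            rw [weightedNorm_powerSeries]
            refine (ENNReal.sum_le_tsum _).trans ?_
            exact ENNReal.tsum_comp_le_tsum_of_injective (add_left_injective q)
              (fun m => ‖PowerSeries.coeff m (subst (Fin.cons PowerSeries.X T :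
                Fin (N + 1) → PowerSeries ℂ) E : PowerSeries ℂ)‖ₑ * r ^ m)
        _ ≤ A * (ENNReal.ofReal t ^ (q + 1) * K) := mul_le_mul_right hTE _
        _ = ENNReal.ofReal t ^ q * (ENNReal.ofReal t * (A * K)) := by ring
        _ ≤ ENNReal.ofReal t ^ q * ENNReal.ofReal r₀ ^ q := mul_le_mul_right ht _
        _ = 1 * r ^ q := by rw [one_mul, hrt, mul_pow]
    exact (ENNReal.mul_le_mul_iff_left (pow_ne_zero _ hr0)
      (ENNReal.pow_ne_top ENNReal.ofReal_ne_top)).1 hsum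

/-! ### Action of `δ` on coefficients, growth of the indicial polynomial, and series in `z` and `z^k
y`. -/

theorem coeff_iterate_delta (φ : PowerSeries ℂ) (i j : ℕ) :
    PowerSeries.coeff j (delta^[i] φ) = (j : ℂ) ^ i * PowerSeries.coeff j φ := by
  induction i with
  | zero => simp
  | succ i ih =>
    rw [Function.iterate_succ_apply', delta]
    cases j with
    | zero => simp
    | succ j =>
      rw [PowerSeries.coeff_succ_X_mul, PowerSeries.coeff_derivative, ih]
      push_cast
      ring

/-- A polynomial with leading coefficient `c_n` is bounded below by `|c_n| x^n / 2` for large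
`x`. -/
theorem exists_norm_sum_ge {n : ℕ} (c : Fin (n + 1) → ℂ) (hc : c (Fin.last n) ≠ 0) :
    ∃ k : ℕ, ∀ x : ℕ, k ≤ x →
      ‖c (Fin.last n)‖ / 2 * (x : ℝ) ^ n ≤ ‖∑ i, c i * (x : ℂ) ^ (i : ℕ)‖ := by
  have hpos : 0 < ‖c (Fin.last n)‖ := norm_pos_iff.2 hc
  set B : ℝ := ∑ i : Fin n, ‖c i.castSucc‖
  obtain ⟨k, hk⟩ := exists_nat_ge (2 * B / ‖c (Fin.last n)‖)
  refine ⟨max k 1, fun x hx => ?_⟩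
  have hx1 : (1 : ℝ) ≤ x := by exact_mod_cast (le_max_right k 1).trans hx
  have hxk : 2 * B / ‖c (Fin.last n)‖ ≤ x :=
    hk.trans (by exact_mod_cast (le_max_left k 1).trans hx)
  have hlow : ‖∑ i : Fin n, c i.castSucc * (x : ℂ) ^ (i : ℕ)‖ * x ≤ B * (x : ℝ) ^ n := by
    refine (mul_le_mul_of_nonneg_right (norm_sum_le _ _) (by positivity)).trans ?_
    rw [Finset.sum_mul, Finset.sum_mul]
    refine Finset.sum_le_sum fun i _ => ?_
    rw [norm_mul, norm_pow, Complex.norm_natCast, mul_assoc, ← pow_succ]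
    exact mul_le_mul_of_nonneg_left (pow_le_pow_right₀ hx1 i.2) (norm_nonneg _)
  have hlow2 : ‖∑ i : Fin n, c i.castSucc * (x : ℂ) ^ (i : ℕ)‖ ≤
      ‖c (Fin.last n)‖ / 2 * (x : ℝ) ^ n := by
    rw [div_le_iff₀ hpos] at hxk
    have hx0 : (0 : ℝ) < x := by linarith
    have hxn : (0 : ℝ) ≤ (x : ℝ) ^ n := by positivity
    refine le_of_mul_le_mul_right (hlow.trans ?_) hx0
    nlinarith
  rw [Fin.sum_univ_castSucc]
  simp only [Fin.val_castSucc, Fin.val_last]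
  have h1 : ‖c (Fin.last n) * (x : ℂ) ^ n‖ = ‖c (Fin.last n)‖ * (x : ℝ) ^ n := by
    rw [norm_mul, norm_pow, Complex.norm_natCast]
  have h2 := norm_sub_le_norm_add (c (Fin.last n) * (x : ℂ) ^ n)
    (∑ i : Fin n, c i.castSucc * (x : ℂ) ^ (i : ℕ))
  rw [add_comm] at h2
  linarith

/-- The multiplicative submonoid of power series in `z, y_0, …` in which `y` occurs only through
`z^k y`. -/
def scaledSubmonoid (N k : ℕ) : Submonoid (MvPowerSeries (Fin (N + 1)) ℂ) where
  carrier := {f | ∀ d, coeff d f ≠ 0 → k * ∑ i : Fin N, d i.succ ≤ d 0}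
  one_mem' := by
    classical
    intro d hd
    rw [coeff_one] at hd
    have : d = 0 := by by_contra h; simp [h] at hd
    simp [this]
  mul_mem' := by
    classical
    intro f g hf hg d hd
    rw [coeff_mul] at hd
    obtain ⟨p, hp, hne⟩ := Finset.exists_ne_zero_of_sum_ne_zero hd
    have h1 := hf p.1 (left_ne_zero_of_mul hne)
    have h2 := hg p.2 (right_ne_zero_of_mul hne)
    rw [← Finset.HasAntidiagonal.mem_antidiagonal.1 hp]
    simp only [Finsupp.add_apply, Finset.sum_add_distrib, mul_add]
    omega

theorem mem_scaledSubmonoid {N k : ℕ} {f : MvPowerSeries (Fin (N + 1)) ℂ} :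
    f ∈ scaledSubmonoid N k ↔ ∀ d, coeff d f ≠ 0 → k * ∑ i : Fin N, d i.succ ≤ d 0 := Iff.rfl

theorem subst_mem_scaledSubmonoid {σ : Type*} {N k : ℕ} {b : σ → MvPowerSeries (Fin (N + 1)) ℂ}
    (hb : HasSubst b) (h : ∀ s, b s ∈ scaledSubmonoid N k) (f : MvPowerSeries σ ℂ) :
    subst b f ∈ scaledSubmonoid N k := by
  rw [mem_scaledSubmonoid]
  intro d hd
  rw [coeff_subst hb] at hd
  obtain ⟨e, he⟩ : ∃ e : σ →₀ ℕ, coeff e f • coeff d (e.prod fun s m => b s ^ m) ≠ 0 := by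
    by_contra! h
    exact hd (finsum_eq_zero_of_forall_eq_zero h)
  have : (e.prod fun s m => b s ^ m) ∈ scaledSubmonoid N k :=
    Submonoid.prod_mem _ fun s _ => Submonoid.pow_mem _ (h s) _
  exact this d (right_ne_zero_of_mul he)

/-! ### The change of variables `y_i = δ^i P + z^k Y_i`. -/

section Shift

variable (φ : PowerSeries ℂ) (k n : ℕ)

/-- The series `δ^i P`, for the truncation `P` of `φ` in degrees `≤ k`, as a series in `z, y`. -/
noncomputable def truncDelta (i : ℕ) : MvPowerSeries (Fin (n + 2)) ℂ :=
  ∑ j ∈ Finset.range (k + 1), monomial (Finsupp.single 0 j) ((j : ℂ) ^ i * PowerSeries.coeff j φ)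

/-- The change of variables `y_i = δ^i P + z^k Y_i`. -/
noncomputable def shift : Fin (n + 2) → MvPowerSeries (Fin (n + 2)) ℂ :=
  Fin.cons (X 0) fun i : Fin (n + 1) => truncDelta φ k n i + X 0 ^ k * X i.succ

/-- The series `(δ + k)^i ψ`, where `φ = P + z^k ψ`. -/
noncomputable def tailDelta (i : ℕ) : PowerSeries ℂ :=
  PowerSeries.mk fun j => if j = 0 then 0 else ((j + k : ℕ) : ℂ) ^ i * PowerSeries.coeff (j + k) φ

variable {φ k n}

theorem X_pow_mul_X (i : Fin (n + 1)) :
    (X 0 ^ k * X i.succ : MvPowerSeries (Fin (n + 2)) ℂ)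
      = monomial (Finsupp.single 0 k + Finsupp.single i.succ 1) 1 := by
  rw [X_pow_eq, X, monomial_mul_monomial, one_mul]

theorem coeff_shift_eq_zero (hφ : PowerSeries.constantCoeff φ = 0) (hk : k ≠ 0) (s : Fin (n + 2))
    (d : Fin (n + 2) →₀ ℕ) (hd : d 0 < 1) : coeff d (shift φ k n s) = 0 := by
  classical
  refine Fin.cases ?_ (fun i => ?_) s
  · rw [shift, Fin.cons_zero, coeff_X, if_neg]
    rintro rfl
    simp at hd
  · rw [shift, Fin.cons_succ, X_pow_mul_X, map_add, truncDelta, map_sum, Finset.sum_eq_zero,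
      zero_add, coeff_monomial, if_neg]
    · rintro rfl
      simp at hd
      omega
    · intro j _
      rw [coeff_monomial]
      split_ifs with h
      · subst h
        have : j = 0 := by simpa using hd
        subst this
        rw [PowerSeries.coeff_zero_eq_constantCoeff_apply, hφ, mul_zero]
      · rfl

theorem hasSubst_shift (hφ : PowerSeries.constantCoeff φ = 0) (hk : k ≠ 0) :
    HasSubst (S := ℂ) (shift φ k n) :=
  hasSubst_of_constantCoeff_zero fun s => by
    rw [← coeff_zero_eq_constantCoeff_apply]
    exact coeff_shift_eq_zero hφ hk s 0 (by simp)

theorem shift_mem_scaledSubmonoid (s : Fin (n + 2)) :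
    shift φ k n s ∈ scaledSubmonoid (n + 1) k := by
  classical
  rw [mem_scaledSubmonoid]
  intro d
  refine Fin.cases ?_ (fun i => ?_) s
  · rw [shift, Fin.cons_zero, coeff_X]
    intro hd
    have : d = Finsupp.single 0 1 := by by_contra h; simp [h] at hd
    simp [this]
  · rw [shift, Fin.cons_succ, X_pow_mul_X, map_add, truncDelta, map_sum]
    intro hd
    by_cases h : d = Finsupp.single 0 k + Finsupp.single i.succ 1
    · subst h
      simp [Finsupp.single_apply]
    · rw [coeff_monomial_ne h, add_zero] at hd
      obtain ⟨j, _, hj⟩ := Finset.exists_ne_zero_of_sum_ne_zero hd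
      have : d = Finsupp.single 0 j := by by_contra h; simp [coeff_monomial_ne h] at hj
      simp [this]

theorem pderiv_shift (i : Fin (n + 1)) (s : Fin (n + 2)) :
    pderiv ℂ i.succ (shift φ k n s) = if s = i.succ then X 0 ^ k else 0 := by
  have h0 : pderiv ℂ i.succ (X 0 : MvPowerSeries (Fin (n + 2)) ℂ) = 0 :=
    pderiv_X_of_ne (Fin.succ_ne_zero i).symm
  refine Fin.cases ?_ (fun j => ?_) s
  · rw [if_neg (Fin.succ_ne_zero i).symm]
    exact h0
  · have ht : pderiv ℂ i.succ (truncDelta φ k n j) = 0 := by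
      rw [truncDelta, map_sum]
      refine Finset.sum_eq_zero fun m _ => ?_
      ext d
      rw [coeff_pderiv, coeff_monomial_ne, zero_mul, map_zero]
      intro h
      have := DFunLike.congr_fun h i.succ
      simp at this
    rw [shift, Fin.cons_succ, map_add, ht, zero_add, Derivation.leibniz, pderiv_pow, h0, mul_zero,
      smul_zero, add_zero, smul_eq_mul]
    by_cases hij : j = i
    · subst hij
      rw [if_pos rfl, pderiv_X_self, mul_one]
    · have : j.succ ≠ i.succ := fun h => hij (Fin.succ_injective _ h)
      rw [if_neg this, pderiv_X_of_ne this, mul_zero]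

theorem hasSubst_cons_X {Θ : Fin n → PowerSeries ℂ}
    (h : ∀ i, PowerSeries.constantCoeff (Θ i) = 0) :
    HasSubst (S := ℂ) (Fin.cons PowerSeries.X Θ : Fin (n + 1) → PowerSeries ℂ) :=
  hasSubst_of_constantCoeff_zero fun s =>
    Fin.cases PowerSeries.constantCoeff_X (fun i => h i) s

theorem coeff_subst_truncDelta {Θ : Fin (n + 1) → PowerSeries ℂ}
    (h : ∀ i, PowerSeries.constantCoeff (Θ i) = 0) (i j : ℕ) :
    PowerSeries.coeff j (subst (Fin.cons PowerSeries.X Θ : Fin (n + 2) → PowerSeries ℂ)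
      (truncDelta φ k n i) : PowerSeries ℂ)
      = if j < k + 1 then (j : ℂ) ^ i * PowerSeries.coeff j φ else 0 := by
  rw [truncDelta, ← coe_substAlgHom (hasSubst_cons_X h), map_sum, map_sum]
  have : ∀ m : ℕ, PowerSeries.coeff j (substAlgHom (R := ℂ) (hasSubst_cons_X h)
      (monomial (Finsupp.single 0 m) ((m : ℂ) ^ i * PowerSeries.coeff m φ)) : PowerSeries ℂ)
      = if j = m then (m : ℂ) ^ i * PowerSeries.coeff m φ else 0 := by
    intro m
    rw [substAlgHom_monomial, Finsupp.prod_single_index (h := fun s e =>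
      (Fin.cons PowerSeries.X Θ : Fin (n + 2) → PowerSeries ℂ) s ^ e) (pow_zero _), Fin.cons_zero]
    change PowerSeries.coeff j (PowerSeries.C _ * PowerSeries.X ^ m) = _
    rw [PowerSeries.coeff_C_mul, PowerSeries.coeff_X_pow]
    simp
  simp only [this]
  rw [Finset.sum_ite_eq]
  simp

theorem subst_shift_succ {Θ : Fin (n + 1) → PowerSeries ℂ}
    (h : ∀ i, PowerSeries.constantCoeff (Θ i) = 0) (i : Fin (n + 1)) :
    (subst (Fin.cons PowerSeries.X Θ : Fin (n + 2) → PowerSeries ℂ)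
      (shift φ k n i.succ) : PowerSeries ℂ)
    = subst (Fin.cons PowerSeries.X Θ : Fin (n + 2) → PowerSeries ℂ) (truncDelta φ k n i)
      + PowerSeries.X ^ k * Θ i := by
  have hs := hasSubst_cons_X h
  rw [shift, Fin.cons_succ, subst_add hs, subst_mul hs, subst_pow hs, subst_X hs, subst_X hs,
    Fin.cons_zero, Fin.cons_succ]

theorem constantCoeff_tailDelta (i : ℕ) : PowerSeries.constantCoeff (tailDelta φ k i) = 0 := by
  rw [← PowerSeries.coeff_zero_eq_constantCoeff_apply, tailDelta, PowerSeries.coeff_mk, if_pos rfl]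

theorem subst_shift_tailDelta :
    (fun s => (subst (Fin.cons PowerSeries.X fun i : Fin (n + 1) => tailDelta φ k i :
      Fin (n + 2) → PowerSeries ℂ) (shift φ k n s) : PowerSeries ℂ)) = jet n φ := by
  have h : ∀ i : Fin (n + 1), PowerSeries.constantCoeff (tailDelta φ k i) = 0 :=
    fun i => constantCoeff_tailDelta i
  funext s
  refine Fin.cases ?_ (fun i => ?_) s
  · exact subst_X (hasSubst_cons_X h) 0
  · rw [subst_shift_succ h]
    ext j
    rw [map_add, coeff_subst_truncDelta h, PowerSeries.coeff_X_pow_mul', jet, Fin.cons_succ,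
      coeff_iterate_delta, tailDelta, PowerSeries.coeff_mk]
    by_cases hj : j < k + 1
    · rw [if_pos hj]
      split_ifs <;> first | omega | simp
    · rw [if_neg hj, if_pos (by omega), if_neg (by omega), Nat.sub_add_cancel (by omega), zero_add]

theorem subst_subst_shift_tailDelta (hφ : PowerSeries.constantCoeff φ = 0) (hk : k ≠ 0)
    (f : MvPowerSeries (Fin (n + 2)) ℂ) :
    (subst (Fin.cons PowerSeries.X fun i : Fin (n + 1) => tailDelta φ k i :
      Fin (n + 2) → PowerSeries ℂ) (subst (shift φ k n) f) : PowerSeries ℂ)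
      = subst (jet n φ) f := by
  rw [subst_comp_subst_apply (hasSubst_shift hφ hk)
    (hasSubst_cons_X fun i => constantCoeff_tailDelta i), subst_shift_tailDelta]

/-- The coefficients of the `Y`-linear part of `f(z, P + z^k Y)`. -/
theorem coeff_subst_shift_linear (hφ : PowerSeries.constantCoeff φ = 0) (hk : k ≠ 0)
    (f : MvPowerSeries (Fin (n + 2)) ℂ) (i : Fin (n + 1)) {a : ℕ} (ha : a < k + (k + 1)) :
    coeff (Finsupp.single 0 a + Finsupp.single i.succ 1) (subst (shift φ k n) f)
      = if k ≤ a then PowerSeries.coeff (a - k)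
          (subst (jet n φ) (pderiv ℂ i.succ f) : PowerSeries ℂ) else 0 := by
  have h0 : ∀ i : Fin (n + 1), PowerSeries.constantCoeff ((0 : Fin (n + 1) → PowerSeries ℂ) i) = 0 :=
    fun i => map_zero _
  have hs := hasSubst_cons_X h0
  have hb := hasSubst_shift (n := n) hφ hk
  have h1 := coeff_pderiv (R := ℂ) (i := i.succ) (subst (shift φ k n) f) (Finsupp.single 0 a)
  rw [Finsupp.single_eq_of_ne (Fin.succ_ne_zero i), Nat.cast_zero, zero_add, mul_one] at h1
  rw [← h1, ← coeff_subst_cons_X_zero, pderiv_subst hb i.succ i.succ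
    (fun s hs => by rw [pderiv_shift, if_neg hs]), pderiv_shift, if_pos rfl, subst_mul hs,
    subst_pow hs, subst_X hs, Fin.cons_zero, PowerSeries.coeff_mul_X_pow']
  split_ifs with hka
  · rw [subst_comp_subst_apply hb hs]
    -- At `Y = 0` the shifted variables become `δ^i P`, which agree with `δ^i φ` through degree `k`;
    -- this is why `a - k ≤ k` is required.
    refine coeff_subst_congr (N := k + 1) ?_ (hasSubst_jet n φ hφ) ?_ _ (by omega)
    · simpa only [substAlgHom_apply] using hb.comp hs
    · intro s j hj
      refine Fin.cases ?_ (fun i => ?_) s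
      · rw [shift, Fin.cons_zero, subst_X hs]
        rfl
      · rw [subst_shift_succ h0, map_add, coeff_subst_truncDelta h0, if_pos hj, Pi.zero_apply,
          mul_zero, map_zero, add_zero, jet, Fin.cons_succ, coeff_iterate_delta]
  · rfl

/-- All components of the shift are divisible by `z`, because `P(0) = 0` and `k ≠ 0`. Shrinking the
`z`-radius alone thus brings them into the polydisc of convergence of `f`, while the radius in `Y`
stays `1`. -/
theorem exists_weightedNorm_subst_shift_lt_top (hφ : PowerSeries.constantCoeff φ = 0)
    (hk : k ≠ 0) {f : MvPowerSeries (Fin (n + 2)) ℂ} {s : ℝ} (hs : 0 < s)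
    (hf : weightedNorm (fun _ => ENNReal.ofReal s) f < ⊤) :
    ∃ r : ℝ, 0 < r ∧ weightedNorm (Fin.cons (ENNReal.ofReal r) 1 : Fin (n + 2) → ℝ≥0∞)
      (subst (shift φ k n) f) < ⊤ := by
  set ρ : Fin (n + 2) → ℝ≥0∞ := Fin.cons 1 1 with hρ
  have hmono : ∀ (d : Fin (n + 2) →₀ ℕ) (c : ℂ), weightedNorm ρ (monomial d c) ≠ ⊤ := by
    intro d c
    have : ρ = fun _ => 1 := by
      funext i; exact Fin.cases rfl (fun _ => rfl) i
    rw [weightedNorm_monomial, this]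
    simp
  have hb : ∀ i, weightedNorm ρ (shift φ k n i) ≠ ⊤ := by
    intro i
    refine Fin.cases (hmono _ _) (fun i => ?_) i
    rw [shift, Fin.cons_succ, X_pow_mul_X]
    refine ne_top_of_le_ne_top ?_ (weightedNorm_add_le _ _ _)
    refine ENNReal.add_ne_top.2 ⟨ne_top_of_le_ne_top ?_ (weightedNorm_sum_le _ _ _), hmono _ _⟩
    exact ENNReal.sum_ne_top.2 fun j _ => hmono _ _
  set B : ℝ≥0∞ := ∑ i, weightedNorm ρ (shift φ k n i)
  have hB : B ≠ ⊤ := ENNReal.sum_ne_top.2 fun i _ => hb i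
  have hB0 : 0 ≤ B.toReal := ENNReal.toReal_nonneg
  set r : ℝ := min 1 (s / (B.toReal + 1))
  refine ⟨r, by positivity, ?_⟩
  refine (weightedNorm_subst_le _ (hasSubst_shift hφ hk) f).trans_lt
    (lt_of_le_of_lt (weightedNorm_mono_weight ?_ f) hf)
  intro i
  have h1 := weightedNorm_mul_left_le (q := 1) (fun d hd => coeff_shift_eq_zero hφ hk i d hd)
    (t := ENNReal.ofReal r) (ENNReal.ofReal_le_one.2 (min_le_left _ _)) 1 1
  rw [mul_one, pow_one] at h1
  refine h1.trans ?_
  calc ENNReal.ofReal r * weightedNorm ρ (shift φ k n i) ≤ ENNReal.ofReal r * B :=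
        mul_le_mul_right (Finset.single_le_sum
          (f := fun i => weightedNorm ρ (shift φ k n i)) (fun _ _ => zero_le) (Finset.mem_univ i)) _
    _ = ENNReal.ofReal (r * B.toReal) := by
        rw [ENNReal.ofReal_mul (by positivity), ENNReal.ofReal_toReal hB]
    _ ≤ ENNReal.ofReal s := by
        refine ENNReal.ofReal_le_ofReal ?_
        calc r * B.toReal ≤ s / (B.toReal + 1) * (B.toReal + 1) :=
              mul_le_mul (min_le_right _ _) (by linarith) hB0 (by positivity)
          _ = s := by field_simp

end Shift

/-! ### The reduced equation and the convergence of its solution. -/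

section Main

variable {φ : PowerSeries ℂ} {k n p : ℕ} {f : MvPowerSeries (Fin (n + 2)) ℂ}

theorem eq_single_add_single_of_sum_eq_one {d : Fin (n + 2) →₀ ℕ}
    (h : ∑ i : Fin (n + 1), d i.succ = 1) :
    ∃ i : Fin (n + 1), d = Finsupp.single 0 (d 0) + Finsupp.single i.succ 1 := by
  obtain ⟨i, _, hi⟩ := Finset.exists_ne_zero_of_sum_ne_zero (h.trans_ne one_ne_zero)
  refine ⟨i, Finsupp.ext fun s => ?_⟩
  rw [← Finset.add_sum_erase _ _ (Finset.mem_univ i)] at h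
  refine Fin.cases ?_ (fun j => ?_) s
  · simp
  · by_cases hj : i = j
    · subst hj
      simp
      omega
    · have h0 : ∑ x ∈ Finset.univ.erase i, d x.succ = 0 := by omega
      have := Finset.sum_eq_zero_iff.1 h0 j (Finset.mem_erase.2 ⟨Ne.symm hj, Finset.mem_univ _⟩)
      simp [this, hj]

theorem eq_single_of_sum_eq_zero {d : Fin (n + 2) →₀ ℕ}
    (h : ∑ i : Fin (n + 1), d i.succ = 0) : d = Finsupp.single 0 (d 0) := by
  refine Finsupp.ext fun s => ?_
  refine Fin.cases ?_ (fun j => ?_) s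
  · simp
  · simpa using Finset.sum_eq_zero_iff.1 h j (Finset.mem_univ _)

/-- Terms linear in `Y` have `z`-order at least `k + p` because every `a_i` has order at least `p`;
terms of higher degree in `Y` have order at least `2k > k + p`. -/
theorem le_of_coeff_subst_shift_ne_zero (hφ : PowerSeries.constantCoeff φ = 0) (hk : p < k)
    (hord : ∀ i : Fin (n + 1), ∀ m < p, PowerSeries.coeff m
      (subst (jet n φ) (pderiv ℂ i.succ f) : PowerSeries ℂ) = 0)
    {d : Fin (n + 2) →₀ ℕ} (hsum : ∑ i : Fin (n + 1), d i.succ ≠ 0)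
    (hd : coeff d (subst (shift φ k n) f) ≠ 0) :
    k + p ≤ d 0 ∧ (d 0 = k + p →
      ∃ i : Fin (n + 1), d = Finsupp.single 0 (k + p) + Finsupp.single i.succ 1) := by
  have hk0 : k ≠ 0 := by omega
  have hmem := subst_mem_scaledSubmonoid (hasSubst_shift (n := n) hφ hk0)
    shift_mem_scaledSubmonoid f d hd
  by_cases h1 : ∑ i : Fin (n + 1), d i.succ = 1
  · obtain ⟨i, hi⟩ := eq_single_add_single_of_sum_eq_one h1
    refine ⟨?_, fun h => ⟨i, by rw [← h]; exact hi⟩⟩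
    by_contra! hlt
    rw [hi, coeff_subst_shift_linear hφ hk0 f i (by omega)] at hd
    split_ifs at hd
    · exact hd (hord i _ (by omega))
    · exact hd rfl
  · have : k * 2 ≤ d 0 := (Nat.mul_le_mul_left k (by omega)).trans hmem
    exact ⟨by omega, fun h => by omega⟩

/-- Inserting the true tail gives `f(z, Φ) = 0`. Terms involving `Y` contribute only from degree `k
+ p + 1` on: `k + p` from their `z`-order and one more because the tail has no constant term. Up to
degree `k + p` the `Y`-free part must therefore vanish by itself. -/
theorem coeff_single_subst_shift (hφ : PowerSeries.constantCoeff φ = 0) (hk : p < k)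
    (hord : ∀ i : Fin (n + 1), ∀ m < p, PowerSeries.coeff m
      (subst (jet n φ) (pderiv ℂ i.succ f) : PowerSeries ℂ) = 0)
    (hf : (subst (jet n φ) f : PowerSeries ℂ) = 0) {a : ℕ} (ha : a ≤ k + p) :
    coeff (Finsupp.single 0 a) (subst (shift φ k n) f) = 0 := by
  have hk0 : k ≠ 0 := by omega
  have hs := hasSubst_cons_X fun i : Fin (n + 1) => constantCoeff_tailDelta (φ := φ) (k := k) i
  have h := congrArg (PowerSeries.coeff a) ((subst_subst_shift_tailDelta hφ hk0 f).trans hf)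
  rw [map_zero, PowerSeries.coeff, coeff_subst hs, finsum_eq_single _ (Finsupp.single 0 a)] at h
  · rw [Finsupp.prod_single_index (h := fun s e =>
      (Fin.cons PowerSeries.X fun i : Fin (n + 1) => tailDelta φ k i :
        Fin (n + 2) → PowerSeries ℂ) s ^ e) (pow_zero _), Fin.cons_zero] at h
    change _ • PowerSeries.coeff a (PowerSeries.X ^ a) = _ at h
    rwa [PowerSeries.coeff_X_pow_self, smul_eq_mul, mul_one] at h
  · intro d hd
    by_cases hE : coeff d (subst (shift φ k n) f) = 0
    · rw [hE, zero_smul]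
    change _ • PowerSeries.coeff a _ = _
    rw [Finsupp.prod_fintype _ _ (fun _ => pow_zero _), Fin.prod_univ_succ]
    simp only [Fin.cons_zero, Fin.cons_succ]
    by_cases hsum : ∑ i : Fin (n + 1), d i.succ = 0
    · have hd0 := eq_single_of_sum_eq_zero hsum
      have hda : a ≠ d 0 := by
        rintro rfl
        exact hd hd0
      have hz : ∀ i : Fin (n + 1), d i.succ = 0 := fun i =>
        Finset.sum_eq_zero_iff.1 hsum i (Finset.mem_univ _)
      simp [hz, PowerSeries.coeff_X_pow, hda]
    · have hle := (le_of_coeff_subst_shift_ne_zero hφ hk hord hsum hE).1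
      obtain ⟨i, _, hi⟩ := Finset.exists_ne_zero_of_sum_ne_zero hsum
      have hX : (PowerSeries.X : PowerSeries ℂ) ∣ ∏ i : Fin (n + 1), tailDelta φ k i ^ d i.succ :=
        ((PowerSeries.X_dvd_iff.2 (constantCoeff_tailDelta (φ := φ) (k := k) i)).trans
          (dvd_pow_self _ hi)).trans
          (Finset.dvd_prod_of_mem (fun i : Fin (n + 1) => tailDelta φ k i ^ d i.succ)
            (Finset.mem_univ i))
      have hX2 := mul_dvd_mul_left (PowerSeries.X ^ d 0 : PowerSeries ℂ) hX
      rw [← pow_succ] at hX2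
      rw [PowerSeries.X_pow_dvd_iff.1 hX2 a (by omega), smul_zero]

theorem converges_of_coeff_mul_pow_le {r M : ℝ} (hr : 0 < r)
    (h : ∀ j : ℕ, ‖PowerSeries.coeff (j + k) φ‖ * r ^ j ≤ M) : Converges φ := by
  refine ⟨r, hr, fun z hz => ?_⟩
  rw [← summable_nat_add_iff k]
  have hq : ‖z‖ / r < 1 := (div_lt_one hr).2 hz
  refine Summable.of_norm_bounded (((summable_geometric_of_lt_one (by positivity) hq).mul_left
    M).mul_right (‖z‖ ^ k)) fun j => ?_
  rw [norm_mul, norm_pow, pow_add, ← mul_assoc]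
  refine mul_le_mul_of_nonneg_right ?_ (by positivity)
  calc ‖PowerSeries.coeff (j + k) φ‖ * ‖z‖ ^ j
      = ‖PowerSeries.coeff (j + k) φ‖ * r ^ j * (‖z‖ / r) ^ j := by
        rw [div_pow]; field_simp
    _ ≤ M * (‖z‖ / r) ^ j := mul_le_mul_of_nonneg_right (h j) (by positivity)

theorem converges_of_isFuchsian {s : ℝ} (hs : 0 < s)
    (hfin : weightedNorm (fun _ => ENNReal.ofReal s) f < ⊤)
    (hφ : PowerSeries.constantCoeff φ = 0) (hf : (subst (jet n φ) f : PowerSeries ℂ) = 0)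
    {a : Fin (n + 1) → PowerSeries ℂ} (ha : ∀ i, a i = subst (jet n φ) (pderiv ℂ i.succ f))
    (hn : a (Fin.last n) ≠ 0) (hFuchs : IsFuchsian a) : Converges φ := by
  classical
  set p := (a (Fin.last n)).order.toNat with hp
  -- The Fuchsian condition enters here: no `a_i` has order below that of `a_n`.
  have hord' : ∀ i : Fin (n + 1), ∀ m < p, PowerSeries.coeff m (a i) = 0 := by
    intro i m hm
    have hlast : (m : ℕ∞) < (a (Fin.last n)).order := by
      rw [← ENat.natCast_toNat (PowerSeries.order_eq_top.not.2 hn)]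
      exact_mod_cast hm
    refine PowerSeries.coeff_of_lt_order m ?_
    refine Fin.lastCases hlast (fun i => hlast.trans_le (hFuchs i)) i
  have hord : ∀ i : Fin (n + 1), ∀ m < p, PowerSeries.coeff m
      (subst (jet n φ) (pderiv ℂ i.succ f) : PowerSeries ℂ) = 0 := by
    intro i m hm
    rw [← ha]
    exact hord' i m hm
  set c : Fin (n + 1) → ℂ := fun i => PowerSeries.coeff p (a i) with hc
  have hcn : c (Fin.last n) ≠ 0 := PowerSeries.coeff_order hn
  have hcpos : 0 < ‖c (Fin.last n)‖ / 2 := half_pos (norm_pos_iff.2 hcn)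
  obtain ⟨k₀, hk₀⟩ := exists_norm_sum_ge c hcn
  -- `k ≥ k₀` makes the lower bound for the indicial polynomial valid at every `j + k`; `k > p`
  -- pushes the nonlinear terms beyond degree `k + p`.
  set k := max k₀ (p + 1) with hkdef
  have hk : p < k := lt_of_lt_of_le (Nat.lt_succ_self p) (le_max_right _ _)
  have hk0 : k ≠ 0 := by omega
  obtain ⟨r₀, hr₀, hEfin⟩ := exists_weightedNorm_subst_shift_lt_top (n := n) hφ hk0 hs hfin
  -- Adding `L` cancels the leading linear part, so that the sum is divisible by `z^(k+p+1)`.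
  set L : MvPowerSeries (Fin (n + 2)) ℂ :=
    ∑ i : Fin (n + 1), monomial (Finsupp.single 0 (k + p) + Finsupp.single i.succ 1) (-c i) with hL
  set Ψ : Fin (n + 1) → PowerSeries ℂ := fun i => tailDelta φ k i with hΨ
  have hΨ0 : ∀ i, PowerSeries.constantCoeff (Ψ i) = 0 := fun i => constantCoeff_tailDelta i
  have hsub := hasSubst_cons_X hΨ0
  have hcoefL : ∀ d : Fin (n + 2) →₀ ℕ, d 0 < k + p + 1 →
      coeff d (subst (shift φ k n) f + L) = 0 := by
    intro d hd
    rw [map_add, hL, map_sum]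
    by_cases hlin : ∃ i : Fin (n + 1), d = Finsupp.single 0 (k + p) + Finsupp.single i.succ 1
    · obtain ⟨i, rfl⟩ := hlin
      rw [coeff_subst_shift_linear hφ hk0 f i (by omega), if_pos (by omega), ← ha,
        Nat.add_sub_cancel_left, Finset.sum_eq_single i]
      · rw [coeff_monomial_same, add_neg_cancel]
      · intro j _ hji
        refine coeff_monomial_ne (fun h => ?_) _
        have := DFunLike.congr_fun h i.succ
        simp [hji] at this
      · simp
    · rw [Finset.sum_eq_zero, add_zero]
      · by_contra hne
        by_cases hsum : ∑ i : Fin (n + 1), d i.succ = 0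
        · rw [eq_single_of_sum_eq_zero hsum] at hne
          exact hne (coeff_single_subst_shift hφ hk hord hf (by omega))
        · obtain ⟨h1, h2⟩ := le_of_coeff_subst_shift_ne_zero hφ hk hord hsum hne
          exact hlin (h2 (by omega))
      · intro i _
        exact coeff_monomial_ne (fun h => hlin ⟨i, h⟩) _
  have hEL : weightedNorm (Fin.cons (ENNReal.ofReal r₀) 1 : Fin (n + 2) → ℝ≥0∞)
      (subst (shift φ k n) f + L) ≠ ⊤ := by
    refine ne_top_of_le_ne_top ?_ (weightedNorm_add_le _ _ _)
    refine ENNReal.add_ne_top.2 ⟨hEfin.ne, ne_top_of_le_ne_top ?_ (weightedNorm_sum_le _ _ _)⟩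
    refine ENNReal.sum_ne_top.2 fun i _ => ?_
    rw [weightedNorm_monomial]
    refine ENNReal.mul_ne_top enorm_ne_top (ENNReal.prod_ne_top fun s _ => ENNReal.pow_ne_top ?_)
    exact Fin.cases ENNReal.ofReal_ne_top (fun _ => ENNReal.one_ne_top) s
  have hLcoef : ∀ j, PowerSeries.coeff (j + (k + p)) (subst (Fin.cons PowerSeries.X Ψ :
      Fin (n + 2) → PowerSeries ℂ) (subst (shift φ k n) f + L) : PowerSeries ℂ)
      = -∑ i, c i * PowerSeries.coeff j (Ψ i) := by
    intro j
    have hm : ∀ i : Fin (n + 1), (substAlgHom (R := ℂ) hsub (monomial (Finsupp.single 0 (k + p) +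
        Finsupp.single i.succ 1) (-c i)) : PowerSeries ℂ)
        = PowerSeries.C (-c i) * (PowerSeries.X ^ (k + p) * Ψ i) := by
      intro i
      rw [substAlgHom_monomial, Finsupp.prod_add_index' (fun _ => pow_zero _)
        (fun _ _ _ => pow_add _ _ _), Finsupp.prod_single_index (h := fun s e =>
        (Fin.cons PowerSeries.X Ψ : Fin (n + 2) → PowerSeries ℂ) s ^ e) (pow_zero _),
        Finsupp.prod_single_index (h := fun s e =>
        (Fin.cons PowerSeries.X Ψ : Fin (n + 2) → PowerSeries ℂ) s ^ e) (pow_zero _),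
        Fin.cons_zero, Fin.cons_succ, pow_one]
      rfl
    rw [subst_add hsub, subst_subst_shift_tailDelta hφ hk0 f, hf, zero_add,
      ← coe_substAlgHom hsub, hL, map_sum, map_sum, ← Finset.sum_neg_distrib]
    refine Finset.sum_congr rfl fun i _ => ?_
    rw [hm, PowerSeries.coeff_C_mul, PowerSeries.coeff_X_pow_mul, neg_mul]
  -- The power `n` dominates all `(j + k)^i` with `i ≤ n`, and is exactly what the indicial
  -- polynomial controls.
  set w : ℕ → ℝ≥0∞ := fun j =>
    if j = 0 then 0 else ENNReal.ofReal (((j + k : ℕ) : ℝ) ^ n * ‖PowerSeries.coeff (j + k) φ‖)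
    with hw
  have hΨw : ∀ i j, ‖PowerSeries.coeff j (Ψ i)‖ₑ ≤ w j := by
    intro i j
    simp only [hΨ, hw, tailDelta, PowerSeries.coeff_mk]
    split_ifs with hj
    · simp
    · rw [← ofReal_norm, norm_mul, norm_pow, Complex.norm_natCast]
      refine ENNReal.ofReal_le_ofReal (mul_le_mul_of_nonneg_right ?_ (norm_nonneg _))
      refine pow_le_pow_right₀ ?_ (Nat.lt_succ_iff.1 i.2)
      exact_mod_cast (by omega : 1 ≤ j + k)
  have hwE : ∀ j, w j ≤ ENNReal.ofReal (‖c (Fin.last n)‖ / 2)⁻¹ *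
      ‖PowerSeries.coeff (j + (k + p)) (subst (Fin.cons PowerSeries.X Ψ :
      Fin (n + 2) → PowerSeries ℂ) (subst (shift φ k n) f + L) : PowerSeries ℂ)‖ₑ := by
    intro j
    by_cases hj : j = 0
    · simp [hw, hj]
    · rw [hLcoef, enorm_neg]
      simp only [hw, hΨ, tailDelta, PowerSeries.coeff_mk, if_neg hj, ← mul_assoc]
      rw [← Finset.sum_mul, ← ofReal_norm, ← ENNReal.ofReal_mul (by positivity), norm_mul]
      refine ENNReal.ofReal_le_ofReal ?_
      rw [← mul_assoc]
      refine mul_le_mul_of_nonneg_right ?_ (norm_nonneg _)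
      rw [inv_mul_eq_div, le_div_iff₀ hcpos, mul_comm]
      exact hk₀ (j + k) ((le_max_left _ _).trans (Nat.le_add_left _ _))
  obtain ⟨r, hr, hsum⟩ := exists_tsum_le_one_of_majorant hcoefL hr₀ hEL hΨ0 hΨw
    ENNReal.ofReal_ne_top hwE
  -- The shift is `k + 1` because `w 0 = 0` says nothing about the coefficient of degree `k`; the
  -- index `j + 1` in `w` costs the factor `r⁻¹`.
  refine converges_of_coeff_mul_pow_le (k := k + 1) (M := r⁻¹) hr fun j => ?_
  have hterm := (ENNReal.le_tsum (j + 1)).trans hsum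
  simp only [hw, if_neg (Nat.succ_ne_zero j)] at hterm
  rw [← ENNReal.ofReal_pow hr.le, ← ENNReal.ofReal_mul (by positivity),
    ENNReal.ofReal_le_one] at hterm
  have hone : (1 : ℝ) ≤ ((j + 1 + k : ℕ) : ℝ) ^ n :=
    one_le_pow₀ (by exact_mod_cast (by omega : 1 ≤ j + 1 + k))
  rw [← one_div, le_div_iff₀ hr, mul_assoc, ← pow_succ, show j + (k + 1) = j + 1 + k by ring]
  refine le_trans (mul_le_mul_of_nonneg_right ?_ (by positivity)) hterm
  exact le_mul_of_one_le_left (norm_nonneg _) hone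

end Main

end FormalODE

theorem theorem1 (n : ℕ) (F : (Fin (n + 2) → ℂ) → ℂ) (hF : AnalyticAt ℂ F 0)
    (φ : PowerSeries ℂ) (hφ₀ : PowerSeries.constantCoeff φ = 0)
    (hφ : FormalODE.alongJet F φ = 0)
    (hn : FormalODE.linearizedCoeff F φ (Fin.last n) ≠ 0)
    (hFuchs : FormalODE.IsFuchsian (FormalODE.linearizedCoeff F φ)) :
    FormalODE.Converges φ := by
  obtain ⟨s, hs, hfin⟩ := FormalODE.exists_weightedNorm_taylorSeries_lt_top hF
  refine FormalODE.converges_of_isFuchsian hs hfin hφ₀ hφ (fun i => ?_) hn hFuchs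
  rw [FormalODE.linearizedCoeff, FormalODE.alongJet, FormalODE.taylorSeries_partialDeriv hF]
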